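/- Let $\Gamma=\mathrm{SL}_2(\mathbb{Z})$ act on the hyperbolic plane $\mathbb{H}^2$ (upper half-plane with $ds^2=(dx^2+dy^2)/y^2$) by Möbius transformations. For an integer $N\ge 1$ let $\Gamma(N)=\ker\big(\mathrm{SL}_2(\mathbb{Z})\to\mathrm{SL}_2(\mathbb{Z}/N\mathbb{Z})\big)$, and put $S=\Gamma\backslash\mathbb{H}^2$ and $S_N=\Gamma(N)\backslash\mathbb{H}^2$, with the distance and the area measure induced from $\mathbb{H}^2$; the area of such a quotient is the hyperbolic area of a fundamental domain. For a hyperbolic surface $X$ let $\mathrm{sys}(X)$ be the infimum of the lengths of the non-contractible closed geodesics of $X$. An element $\gamma\in\Gamma(N)$ is said to represent a systole of $S_N$ if $\gamma$ translates along a geodesic line of $\mathbb{H}^2$ (its axis) and the projection of this axis to $S_N$, run through once from $z$ to $\gamma z$, is a non-contractible closed geodesic of length $\mathrm{sys}(S_N)$. Let $N\ge 5$. Then: (a) Every $\gamma\in\Gamma(N)$ with $|\mathrm{tr}(\gamma)|\ne 2$ satisfies $|\mathrm{tr}(\gamma)|\ge N^2-2$. (b) If $\beta\in\mathrm{SL}_2(\mathbb{Z})$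 has $\mathrm{tr}(\beta)=\pm N$, then $-\beta^2\in\Gamma(N)$ and $-\beta^2$ represents a systole of $S_N$. (c) $\Gamma(N)$ acts properly discontinuously and without fixed points on $\mathbb{H}^2$, and $S_N$ is a non-compact hyperbolic surface (a connected surface with a complete Riemannian metric locally isometric to $\mathbb{H}^2$) with $\mathrm{area}(S_N)<\mathrm{area}(S)\cdot N^3$. -/

import Mathlib

open scoped MatrixGroups UpperHalfPlane Topology

/-! ### The quotient of the hyperbolic plane by a subgroup of `SL(2, ℤ)` -/

/-- The quotient `Γ \ ℍ`, with the quotient topology. -/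
abbrev HypQuotient (Γ : Subgroup SL(2, ℤ)) : Type :=
  MulAction.orbitRel.Quotient Γ ℍ

namespace HypQuotient

variable {Γ : Subgroup SL(2, ℤ)}

/-- The projection `ℍ → Γ \ ℍ`. -/
noncomputable def proj (Γ : Subgroup SL(2, ℤ)) (z : ℍ) : HypQuotient Γ :=
  Quotient.mk _ z

/-- The distance between two points of `Γ \ ℍ`: the infimum of the hyperbolic distances between
their lifts to `ℍ`. -/
noncomputable def qdist (p q : HypQuotient Γ) : ℝ :=
  sInf {r : ℝ | ∃ z w : ℍ, proj Γ z = p ∧ proj Γ w = q ∧ dist z w = r}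

theorem proj_surjective (p : HypQuotient Γ) : ∃ z, proj Γ z = p :=
  Quotient.exists_rep p

theorem proj_eq_iff {z w : ℍ} : proj Γ z = proj Γ w ↔ ∃ g : Γ, g • w = z :=
  Quotient.eq.trans MulAction.orbitRel_apply

theorem dist_smul_smul (g : Γ) (z w : ℍ) : dist (g • z) (g • w) = dist z w := by
  have h : ∀ x : ℍ,
      g • x = (Matrix.SpecialLinearGroup.map (Int.castRingHom ℝ) (g : SL(2, ℤ))) • x :=
    fun x => rfl
  rw [h, h, dist_smul]

theorem qdist_bddBelow (p q : HypQuotient Γ) :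
    BddBelow {r : ℝ | ∃ z w : ℍ, proj Γ z = p ∧ proj Γ w = q ∧ dist z w = r} :=
  ⟨0, by rintro _ ⟨z, w, -, -, rfl⟩; exact dist_nonneg⟩

theorem qdist_nonneg (p q : HypQuotient Γ) : 0 ≤ qdist p q :=
  Real.sInf_nonneg (by rintro _ ⟨z, w, -, -, rfl⟩; exact dist_nonneg)

theorem qdist_proj_le (z w : ℍ) : qdist (proj Γ z) (proj Γ w) ≤ dist z w :=
  csInf_le (qdist_bddBelow _ _) ⟨z, w, rfl, rfl, rfl⟩

theorem exists_dist_lt {z : ℍ} {q : HypQuotient Γ} {r : ℝ} (h : qdist (proj Γ z) q < r) :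
    ∃ w, proj Γ w = q ∧ dist z w < r := by
  obtain ⟨w₀, hw₀⟩ := proj_surjective q
  obtain ⟨_, ⟨z', w, hz', hw, rfl⟩, hlt⟩ :=
    exists_lt_of_csInf_lt (by exact ⟨_, z, w₀, rfl, hw₀, rfl⟩) h
  obtain ⟨g, hg⟩ := proj_eq_iff.1 hz'.symm
  refine ⟨g • w, ?_, ?_⟩
  · rw [← hw]; exact proj_eq_iff.2 ⟨g, rfl⟩
  · rwa [← hg, dist_smul_smul]

theorem qdist_comm (p q : HypQuotient Γ) : qdist p q = qdist q p := by
  unfold qdist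
  congr 1
  ext r
  constructor <;> rintro ⟨z, w, hz, hw, h⟩ <;> exact ⟨w, z, hw, hz, by rw [dist_comm, h]⟩

theorem qdist_self (p : HypQuotient Γ) : qdist p p = 0 := by
  obtain ⟨z, rfl⟩ := proj_surjective p
  exact le_antisymm (by simpa using qdist_proj_le (Γ := Γ) z z) (qdist_nonneg _ _)

theorem qdist_triangle (p q s : HypQuotient Γ) : qdist p s ≤ qdist p q + qdist q s := by
  refine le_of_forall_pos_le_add fun ε hε => ?_
  obtain ⟨z, rfl⟩ := proj_surjective p
  obtain ⟨w, rfl, hw⟩ := exists_dist_lt (lt_add_of_pos_right (qdist (proj Γ z) q) (half_pos hε))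
  obtain ⟨v, rfl, hv⟩ := exists_dist_lt
    (lt_add_of_pos_right (qdist (proj Γ w) s) (half_pos hε))
  linarith [qdist_proj_le (Γ := Γ) z v, dist_triangle z w v]

theorem isOpen_iff_qdist (s : Set (HypQuotient Γ)) :
    IsOpen s ↔ ∀ p ∈ s, ∃ ε > 0, ∀ q, qdist p q < ε → q ∈ s := by
  have h : IsOpen s ↔ IsOpen (proj Γ ⁻¹' s) := isQuotientMap_quot_mk.isOpen_preimage.symm
  rw [h, Metric.isOpen_iff]
  constructor
  · intro H p hp
    obtain ⟨z, rfl⟩ := proj_surjective p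
    obtain ⟨ε, hε, hb⟩ := H z hp
    refine ⟨ε, hε, fun q hq => ?_⟩
    obtain ⟨w, rfl, hw⟩ := exists_dist_lt hq
    exact hb (by rwa [Metric.mem_ball, dist_comm])
  · intro H z hz
    obtain ⟨ε, hε, hb⟩ := H _ hz
    refine ⟨ε, hε, fun w hw => hb _ ?_⟩
    rw [Metric.mem_ball, dist_comm] at hw
    exact (qdist_proj_le z w).trans_lt hw

/-- The quotient distance on `Γ \ ℍ`; it induces the quotient topology. -/
noncomputable instance : PseudoMetricSpace (HypQuotient Γ) :=
  letI : Dist (HypQuotient Γ) := ⟨qdist⟩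
  PseudoMetricSpace.ofDistTopology qdist qdist_self qdist_comm qdist_triangle isOpen_iff_qdist

end HypQuotient

/-! ### Hyperbolic surfaces -/

/-- `X` is a hyperbolic surface: a connected, second countable Hausdorff space with a complete
length metric (stated in the form that any two points are joined by a minimizing geodesic segment)
and with an atlas of charts to `ℍ` that preserve distances and whose transition maps are locally
restrictions of isometries of `ℍ`. So `X` is a smooth surface whose distance comes from a complete
Riemannian metric locally isometric to the hyperbolic plane. -/
structure IsHyperbolicSurface (X : Type*) [PseudoMetricSpace X] : Prop where
  t2 : T2Space X
  secondCountable : SecondCountableTopology X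
  connected : ConnectedSpace X
  complete : CompleteSpace X
  exists_segment : ∀ p q : X, ∃ c : ℝ → X, c 0 = p ∧ c (dist p q) = q ∧
    ∀ s ∈ Set.Icc 0 (dist p q), ∀ t ∈ Set.Icc 0 (dist p q), dist (c s) (c t) = |s - t|
  exists_atlas : ∃ A : Set (OpenPartialHomeomorph X ℍ),
    (∀ x, ∃ e ∈ A, x ∈ e.source) ∧
    (∀ e ∈ A, ∀ x ∈ e.source, ∀ y ∈ e.source, dist (e x) (e y) = dist x y) ∧
    (∀ e ∈ A, ∀ e' ∈ A, ∀ z ∈ (e.symm.trans e').source,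
      ∃ g : ℍ ≃ᵢ ℍ, ∀ᶠ w in 𝓝 z, (e.symm.trans e') w = g w)

/-! ### Closed geodesics and systoles -/

/-- `α` is a closed geodesic of length `L`, parametrized by arc length: locally, the distance
between two points of the curve is the length of the arc between them. -/
def IsClosedGeodesic {X : Type*} [PseudoMetricSpace X] {L : ℝ} (α : C(AddCircle L, X)) : Prop :=
  0 < L ∧ ∀ t : ℝ, ∃ ε > 0, ∀ s ∈ Metric.ball t ε, ∀ s' ∈ Metric.ball t ε,
    dist (α (s : AddCircle L)) (α (s' : AddCircle L)) = |s - s'|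

/-- The systole of `X`: the infimum of the lengths of its non-contractible closed geodesics. -/
noncomputable def sys (X : Type*) [PseudoMetricSpace X] : ℝ :=
  sInf {L : ℝ | ∃ α : C(AddCircle L, X), IsClosedGeodesic α ∧ ¬ α.Nullhomotopic}

/-- The closed curve `α` in `Γ \ ℍ` is the projection of the axis of `γ`: there is a complete
geodesic `c` of `ℍ`, parametrized by arc length, along which `γ` translates by `L`, and `α` is its
image in `Γ \ ℍ`, run through once between `c t` and `γ • c t`. -/
def IsProjectedAxis {Γ : Subgroup SL(2, ℤ)} (γ : SL(2, ℤ)) {L : ℝ}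
    (α : C(AddCircle L, HypQuotient Γ)) : Prop :=
  ∃ c : ℝ → ℍ, Isometry c ∧ (∀ t, γ • c t = c (t + L)) ∧
    ∀ t : ℝ, α (t : AddCircle L) = HypQuotient.proj Γ (c t)

/-- `γ ∈ Γ` represents a systole of `Γ \ ℍ`: its axis projects to a non-contractible closed
geodesic whose length is the systole of `Γ \ ℍ`. -/
def RepresentsSystole (Γ : Subgroup SL(2, ℤ)) (γ : SL(2, ℤ)) : Prop :=
  γ ∈ Γ ∧ ∃ (L : ℝ) (α : C(AddCircle L, HypQuotient Γ)),
    IsProjectedAxis γ α ∧ IsClosedGeodesic α ∧ ¬ α.Nullhomotopic ∧ L = sys (HypQuotient Γ)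

/-! ### Area -/

/-- The image of `Γ` in the group of transformations of `ℍ` (where `1` and `-1` are identified). -/
noncomputable abbrev transformationGroup (Γ : Subgroup SL(2, ℤ)) : Subgroup (Equiv.Perm ℍ) :=
  (MulAction.toPermHom Γ ℍ).range

/-- The area of `Γ \ ℍ`: the hyperbolic area (for `dx dy / y ^ 2`) of a fundamental domain of the
group of transformations of `ℍ` given by `Γ`. -/
noncomputable def area (Γ : Subgroup SL(2, ℤ)) : ENNReal :=
  MeasureTheory.covolume (transformationGroup Γ) ℍ

/-! ### Displacement of Möbius transformations -/

namespace UpperHalfPlane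

/-! Write an element of Γ(N) as 1 + N M with M integral. Determinant one forces its trace to be 2 -
N² det M (`exists_trace_eq_of_mem_Gamma`), so a trace other than ±2 is at least N² - 2 in absolute
value. Hence Γ(N) has no elliptic elements, and it acts freely. By Cayley–Hamilton, -β² = 1 - tr(β)
β; if tr β = ±N this lies in Γ(N) and its trace 2 - N² attains the bound.

Traces become lengths through `two_add_two_mul_cosh_dist_smul`: every displacement d of g satisfies
|tr g| ≤ 2 cosh (d / 2), and `exists_axis` gives a line on which equality holds when |tr g| > 2. A
closed geodesic of the quotient lifts through the covering by ℍ to a geodesic translated by some γ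
in Γ(N). Its trace is not ±2, since such a γ preserves height above some boundary point, while
height along a geodesic has no local minimum and so cannot be periodic (`not_periodic_im`). Every
closed geodesic thus obeys the trace bound, and the axis of -β² attains it. That axis projects to a
non-contractible curve, because lifting a nullhomotopy would produce a fixed point.

For the area, a fundamental domain of Γ(N) is assembled from translates of the modular one, fewer
than N³ of them because |SL₂(ℤ/N)| < N³. The modular domain has positive finite area, so the
inequality stays strict. -/

theorem SL2Z_smul_eq (g : SL(2, ℤ)) (z : ℍ) :
    g • z = (Matrix.SpecialLinearGroup.map (Int.castRingHom ℝ) g) • z := rfl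

theorem im_SL2R_smul (g : SL(2, ℝ)) (z : ℍ) :
    (g • z).im = z.im / Complex.normSq ((g 1 0 : ℂ) * z + g 1 1) := by
  rw [MulAction.compHom_smul_def, UpperHalfPlane.im_smul_eq_div_normSq]
  simp [denom]

theorem SL2R_denom_ne_zero (g : SL(2, ℝ)) (z : ℍ) : (g 1 0 : ℂ) * z + g 1 1 ≠ 0 :=
  denom_ne_zero (g : GL (Fin 2) ℝ) z

/-- The numerator is the quadratic polynomial whose roots are the fixed points of `g`. -/
theorem cosh_dist_smul (g : SL(2, ℝ)) (z : ℍ) :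
    Real.cosh (dist z (g • z)) = 1 + Complex.normSq
      ((g 1 0 : ℂ) * z ^ 2 + ((g 1 1 : ℂ) - g 0 0) * z - g 0 1) / (2 * z.im ^ 2) := by
  have hd := SL2R_denom_ne_zero g z
  have hy := z.im_pos
  have hn : Complex.normSq ((g 1 0 : ℂ) * z + g 1 1) ≠ 0 := by simpa using hd
  have h : (z : ℂ) - (g • z : ℍ) = ((g 1 0 : ℂ) * z ^ 2 + ((g 1 1 : ℂ) - g 0 0) * z - g 0 1) /
      ((g 1 0 : ℂ) * z + g 1 1) := by
    rw [coe_specialLinearGroup_apply]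
    simp only [Algebra.algebraMap_self, RingHom.id_apply]
    rw [eq_div_iff hd, sub_mul, div_mul_cancel₀ _ hd]
    ring
  rw [cosh_dist, Complex.dist_eq, ← Complex.normSq_eq_norm_sq, h, Complex.normSq_div,
    im_SL2R_smul]
  field_simp

/-- Separating real and imaginary parts and using det = 1 isolates the trace; the remaining square
measures how far `z` is from the axis. -/
theorem two_add_two_mul_cosh_dist_smul (g : SL(2, ℝ)) (z : ℍ) :
    2 + 2 * Real.cosh (dist z (g • z)) = (g 0 0 + g 1 1) ^ 2 +
      ((g 1 0 * (z.re ^ 2 + z.im ^ 2) + (g 1 1 - g 0 0) * z.re - g 0 1) / z.im) ^ 2 := by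
  have hy := z.im_pos
  have hdet : g 0 0 * g 1 1 - g 0 1 * g 1 0 = 1 := by
    have := g.det_coe; rwa [Matrix.det_fin_two] at this
  rw [cosh_dist_smul]
  have hP : Complex.normSq ((g 1 0 : ℂ) * z ^ 2 + ((g 1 1 : ℂ) - g 0 0) * z - g 0 1) =
      (g 1 0 * (z.re ^ 2 - z.im ^ 2) + (g 1 1 - g 0 0) * z.re - g 0 1) ^ 2 +
      (2 * g 1 0 * z.re * z.im + (g 1 1 - g 0 0) * z.im) ^ 2 := by
    rw [Complex.normSq_apply]
    simp [pow_two]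
    ring
  rw [hP]
  field_simp
  linear_combination (-4 * z.im ^ 2) * hdet

theorem abs_trace_le_two_mul_cosh (g : SL(2, ℝ)) (z : ℍ) :
    |g 0 0 + g 1 1| ≤ 2 * Real.cosh (dist z (g • z) / 2) := by
  apply abs_le_of_sq_le_sq
  · have h := two_add_two_mul_cosh_dist_smul g z
    have h2 := Real.cosh_sq (dist z (g • z) / 2)
    have h3 := Real.cosh_two_mul (dist z (g • z) / 2)
    rw [mul_div_cancel₀ _ (two_ne_zero)] at h3
    nlinarith [sq_nonneg ((g 1 0 * (z.re ^ 2 + z.im ^ 2) + (g 1 1 - g 0 0) * z.re - g 0 1) / z.im)]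
  · have := Real.cosh_pos (dist z (g • z) / 2)
    positivity

/-- A matrix with `|tr| ≥ 2` and a fixed point in `ℍ` is scalar. -/
theorem eq_of_smul_eq_of_two_le_abs_trace (g : SL(2, ℝ)) (z : ℍ) (h : g • z = z)
    (ht : 2 ≤ |g 0 0 + g 1 1|) : g 1 0 = 0 ∧ g 0 1 = 0 ∧ g 0 0 = g 1 1 := by
  have hy := z.im_pos
  have hP := cosh_dist_smul g z
  rw [h, dist_self, Real.cosh_zero, left_eq_add, div_eq_zero_iff,
    or_iff_left (by positivity), Complex.normSq_eq_zero] at hP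
  have hre := congrArg Complex.re hP
  have him := congrArg Complex.im hP
  simp [pow_two] at hre him
  have hdet : g 0 0 * g 1 1 - g 0 1 * g 1 0 = 1 := by
    have := g.det_coe; rwa [Matrix.det_fin_two] at this
  have h4 : 4 ≤ (g 0 0 + g 1 1) ^ 2 := by
    rw [← sq_abs]; nlinarith
  have him' : 2 * g 1 0 * z.re + (g 1 1 - g 0 0) = 0 := by
    have : z.im * (2 * g 1 0 * z.re + (g 1 1 - g 0 0)) = 0 := by linarith
    rcases mul_eq_zero.1 this with h | h
    · exact absurd h hy.ne'
    · exact h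
  have hda : g 1 1 - g 0 0 = -(2 * g 1 0 * z.re) := by linarith
  rw [hda] at hre
  have hb : g 0 1 = -(g 1 0 * (z.re ^ 2 + z.im ^ 2)) := by linarith
  -- A fixed point makes tr² equal to 4 - 4 (c y)², so tr² ≥ 4 forces c y = 0.
  have hc : (g 1 0 * z.im) ^ 2 ≤ 0 := by
    have : (g 0 0 + g 1 1) ^ 2 = 4 - 4 * (g 1 0 * z.im) ^ 2 := by
      have : (g 0 0 + g 1 1) ^ 2 = (g 1 1 - g 0 0) ^ 2 + 4 * (g 0 0 * g 1 1) := by ring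
      rw [this, hda, show g 0 0 * g 1 1 = 1 + g 0 1 * g 1 0 by linarith, hb]
      ring
    linarith
  have hc0 : g 1 0 = 0 := by
    have : g 1 0 * z.im = 0 := by
      exact pow_eq_zero_iff two_ne_zero |>.1 (le_antisymm hc (sq_nonneg _))
    exact (mul_eq_zero.1 this).resolve_right hy.ne'
  refine ⟨hc0, by rw [hb, hc0]; ring, ?_⟩
  rw [hc0] at hda
  linarith

/-! ### Axes of hyperbolic transformations -/

theorem isometry_smul_vertical_line (g : SL(2, ℝ)) :
    Isometry fun t : ℝ => g • (mk ⟨0, Real.exp t⟩ (Real.exp_pos t) : ℍ) :=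
  (isometry_smul ℍ g).comp (isometry_vertical_line 0)

/-- A matrix with `|tr| > 2` and nonzero lower left entry translates along a geodesic line, by the
length `L` determined by `2 cosh (L / 2) = |tr|`. -/
theorem exists_axis (g : SL(2, ℝ)) (hc : g 1 0 ≠ 0) (ht : 2 < |g 0 0 + g 1 1|) :
    ∃ (L : ℝ) (c : ℝ → ℍ), 0 < L ∧ 2 * Real.cosh (L / 2) = |g 0 0 + g 1 1| ∧ Isometry c ∧
      ∀ t, g • c t = c (t + L) := by
  have hdet : g 0 0 * g 1 1 - g 0 1 * g 1 0 = 1 := by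
    have := g.det_coe; rwa [Matrix.det_fin_two] at this
  -- `l` is the eigenvalue of larger absolute value.
  obtain ⟨l, hl, hl1⟩ : ∃ l : ℝ, l ^ 2 - (g 0 0 + g 1 1) * l + 1 = 0 ∧ 1 < |l| := by
    set T := g 0 0 + g 1 1
    have h4 : 4 < T ^ 2 := by rw [← sq_abs]; nlinarith
    have hs := Real.sq_sqrt (show 0 ≤ T ^ 2 - 4 by linarith)
    have hs0 := Real.sqrt_nonneg (T ^ 2 - 4)
    rcases le_total 0 T with h | h
    · rw [abs_of_nonneg h] at ht
      refine ⟨(T + √(T ^ 2 - 4)) / 2, by linear_combination hs / 4, ?_⟩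
      rw [abs_of_nonneg (by linarith)]; linarith
    · rw [abs_of_nonpos h] at ht
      refine ⟨(T - √(T ^ 2 - 4)) / 2, by linear_combination hs / 4, ?_⟩
      rw [abs_of_nonpos (by linarith)]; linarith
  have hl0 : l ≠ 0 := by rintro rfl; simp at hl1; linarith
  have hll : 1 < l ^ 2 := by rw [← sq_abs]; nlinarith
  have hne : l - l⁻¹ ≠ 0 := by
    intro h
    have : l ^ 2 = 1 := by field_simp at h; linarith
    linarith
  have htr : g 0 0 + g 1 1 = l + l⁻¹ := by
    field_simp
    linarith
  -- The columns of `p` are eigenvectors for `l` and `l⁻¹`, scaled to determinant one. So `p`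
  -- carries the imaginary axis, where `D` acts as multiplication by l², to the axis of `g`.
  let p : SL(2, ℝ) := ⟨!![l - g 1 1, (l⁻¹ - g 1 1) / (g 1 0 * (l - l⁻¹)); g 1 0, 1 / (l - l⁻¹)], by
    rw [Matrix.det_fin_two_of]
    generalize l⁻¹ = m at hne ⊢
    field_simp
    ring⟩
  let D : SL(2, ℝ) := ⟨!![l, 0; 0, l⁻¹], by rw [Matrix.det_fin_two_of]; field_simp; ring⟩
  have hconj : g * p = p * D := by
    have ha : g 0 0 = l + l⁻¹ - g 1 1 := by linarith
    have hb : g 0 1 = (g 0 0 * g 1 1 - 1) / g 1 0 := by field_simp; linarith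
    ext i j
    rw [Matrix.SpecialLinearGroup.coe_mul, Matrix.SpecialLinearGroup.coe_mul,
      Matrix.mul_apply, Matrix.mul_apply]
    fin_cases i <;> fin_cases j <;> simp [p, D, Fin.sum_univ_two]
    · rw [hb, ha]; field_simp; ring
    · rw [hb, ha]; field_simp; ring
    · ring
    · field_simp; ring
  have hlabs : 0 < |l| := by positivity
  refine ⟨2 * Real.log |l|, _, by have := Real.log_pos hl1; linarith, ?_,
    isometry_smul_vertical_line p, fun t => ?_⟩
  · rw [mul_div_cancel_left₀ _ (two_ne_zero), Real.cosh_eq, Real.exp_neg, Real.exp_log hlabs, htr]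
    rcases lt_or_gt_of_ne hl0 with h | h
    · have : l⁻¹ < 0 := inv_lt_zero.2 h
      rw [abs_of_neg h, abs_of_neg (by linarith), inv_neg]; ring
    · have : 0 < l⁻¹ := inv_pos.2 h
      rw [abs_of_pos h, abs_of_pos (by linarith)]; ring
  · rw [← mul_smul, hconj, mul_smul]
    congr 1
    ext1
    rw [coe_specialLinearGroup_apply]
    have he : Real.exp (t + 2 * Real.log |l|) = l ^ 2 * Real.exp t := by
      rw [Real.exp_add, two_mul, Real.exp_add, Real.exp_log hlabs, ← sq, sq_abs]; ring
    have hlC : (l : ℂ) ≠ 0 := by exact_mod_cast hl0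
    simp only [D, he]
    apply Complex.ext
    · simp
    · simp
      field_simp

/-! ### Geodesic segments -/

theorem cosh_dist_eq (z w : ℍ) : Real.cosh (dist z w) =
    ((z.re - w.re) ^ 2 + z.im ^ 2 + w.im ^ 2) / (2 * z.im * w.im) :=
  cosh_dist' z w

theorem dist_eq_abs_of_cosh_eq {z w : ℍ} {r : ℝ} (h : Real.cosh (dist z w) = Real.cosh r) :
    dist z w = |r| := by
  rw [← abs_of_nonneg (dist_nonneg (x := z) (y := w))]
  exact le_antisymm (Real.cosh_le_cosh.1 h.le) (Real.cosh_le_cosh.1 h.ge)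

/-- The half circle with centre `a` and radius `r`, parametrized by arc length. -/
noncomputable def halfCircle (a r : ℝ) (hr : 0 < r) (t : ℝ) : ℍ :=
  mk ⟨a + r * Real.sinh t / Real.cosh t, r / Real.cosh t⟩ (div_pos hr (Real.cosh_pos t))

theorem isometry_halfCircle (a r : ℝ) (hr : 0 < r) : Isometry (halfCircle a r hr) := by
  refine Isometry.of_dist_eq fun s t => ?_
  rw [Real.dist_eq]
  apply dist_eq_abs_of_cosh_eq
  have hs := (Real.cosh_pos s).ne'
  have ht := (Real.cosh_pos t).ne'
  have hs2 := Real.cosh_sq s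
  have ht2 := Real.cosh_sq t
  rw [cosh_dist_eq, Real.cosh_sub]
  simp only [halfCircle, mk_re, mk_im]
  field_simp
  linear_combination (- r ^ 2 * Real.cosh t ^ 2) * hs2 - r ^ 2 * Real.cosh s ^ 2 * ht2

theorem exists_halfCircle_eq (a r : ℝ) (hr : 0 < r) (z : ℍ)
    (h : (z.re - a) ^ 2 + z.im ^ 2 = r ^ 2) : ∃ t, halfCircle a r hr t = z := by
  have hy := z.im_pos
  refine ⟨Real.arsinh ((z.re - a) / z.im), ?_⟩
  have hc : Real.cosh (Real.arsinh ((z.re - a) / z.im)) = r / z.im := by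
    rw [Real.cosh_arsinh, Real.sqrt_eq_iff_mul_self_eq (by positivity) (by positivity)]
    field_simp
    linarith
  ext1
  apply Complex.ext <;> simp [halfCircle, hc, Real.sinh_arsinh] <;> field_simp
  ring

/-- Any two points of `ℍ` lie on a geodesic line. -/
theorem exists_isometry_through (z w : ℍ) :
    ∃ c : ℝ → ℍ, Isometry c ∧ c 0 = z ∧ c (dist z w) = w := by
  obtain ⟨c, s, t, hc, hs, ht⟩ : ∃ (c : ℝ → ℍ) (s t : ℝ), Isometry c ∧ c s = z ∧ c t = w := by
    by_cases h : z.re = w.re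
    · refine ⟨_, Real.log z.im, Real.log w.im, isometry_vertical_line z.re, ?_, ?_⟩
      · ext1; apply Complex.ext <;> simp [Real.exp_log z.im_pos]
      · ext1; apply Complex.ext <;> simp [Real.exp_log w.im_pos, h]
    · have hne : z.re - w.re ≠ 0 := sub_ne_zero.2 h
      -- The point of the real line at equal Euclidean distance from `z` and `w`.
      set a := (z.re ^ 2 + z.im ^ 2 - w.re ^ 2 - w.im ^ 2) / (2 * (z.re - w.re)) with ha
      have hy := z.im_pos
      have h0 : 0 < (z.re - a) ^ 2 + z.im ^ 2 := by positivity
      have hr := Real.sqrt_pos.2 h0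
      obtain ⟨s, hs⟩ := exists_halfCircle_eq a _ hr z (Real.sq_sqrt h0.le).symm
      obtain ⟨t, ht⟩ := exists_halfCircle_eq a _ hr w (by
        rw [Real.sq_sqrt h0.le, ha]; field_simp; ring)
      exact ⟨_, s, t, isometry_halfCircle _ _ hr, hs, ht⟩
  have hd : dist z w = |s - t| := by rw [← hs, ← ht, hc.dist_eq, Real.dist_eq]
  rcases le_total s t with h | h
  · refine ⟨fun u => c (s + u), hc.comp (Isometry.of_dist_eq fun x y => by simp), by simp [hs], ?_⟩
    rw [hd, abs_of_nonpos (by linarith), ← ht]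
    ring_nf
  · refine ⟨fun u => c (s - u), hc.comp (Isometry.of_dist_eq fun x y => by
      rw [Real.dist_eq, Real.dist_eq, ← abs_neg]; congr 1; ring), by simp [hs], ?_⟩
    rw [hd, abs_of_nonneg (by linarith), ← ht]
    ring_nf

/-- The height has no local minimum in the interior of a geodesic segment. -/
theorem min_im_lt_im_midpoint {a m b : ℍ} {e : ℝ} (he : 0 < e) (h1 : dist a m = e)
    (h2 : dist m b = e) (h3 : dist a b = 2 * e) : min a.im b.im < m.im := by
  by_contra! hcon
  obtain ⟨ha, hb⟩ := le_min_iff.1 hcon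
  have hm := m.im_pos
  have hap := a.im_pos
  have hbp := b.im_pos
  have hC : 1 < Real.cosh e := Real.one_lt_cosh.2 he.ne'
  have h1' := cosh_dist_eq a m
  have h2' := cosh_dist_eq m b
  have h3' := cosh_dist_eq a b
  rw [h1] at h1'
  rw [h2] at h2'
  rw [h3, Real.cosh_two_mul, Real.sinh_sq] at h3'
  generalize Real.cosh e = C at *
  field_simp at h1' h2' h3'
  -- By the three distance formulas, four times the product of these two positive numbers equals
  -- minus a sum of two squares.
  have k1 : 0 < C * a.im - m.im := by nlinarith
  have k2 : 0 < C * b.im - m.im := by nlinarith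
  have := mul_pos k1 k2
  nlinarith [sq_nonneg (a.im - b.im), sq_nonneg ((a.re - m.re) + (b.re - m.re))]

end UpperHalfPlane

/-! ### The quotient as a hyperbolic surface -/

instance properlyDiscontinuousSMul_SL2Z (Γ : Subgroup SL(2, ℤ)) :
    ProperlyDiscontinuousSMul Γ ℍ where
  finite_disjoint_inter_image {K L} hK hL := by
    have h := properlyDiscontinuousSL2ZRange.finite_disjoint_inter_image hK hL
    let f : Γ → (Matrix.SpecialLinearGroup.mapGL (n := Fin 2) (R := ℤ) ℝ).range :=
      fun g => ⟨_, g.1, rfl⟩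
    have hf : Function.Injective f := fun a b hab =>
      Subtype.ext (Matrix.SpecialLinearGroup.mapGL_injective (congrArg Subtype.val hab))
    exact (h.preimage hf.injOn).subset fun g hg => hg

instance continuousConstSMul_SL2Z (Γ : Subgroup SL(2, ℤ)) : ContinuousConstSMul Γ ℍ where
  continuous_const_smul g :=
    (Isometry.of_dist_eq (HypQuotient.dist_smul_smul g)).continuous

namespace HypQuotient

variable {Γ : Subgroup SL(2, ℤ)}

theorem dist_proj_le (z w : ℍ) : dist (proj Γ z) (proj Γ w) ≤ dist z w := qdist_proj_le z w

theorem proj_smul (g : Γ) (z : ℍ) : proj Γ (g • z) = proj Γ z := proj_eq_iff.2 ⟨g, rfl⟩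

theorem continuous_proj : Continuous (proj Γ) := continuous_quot_mk

theorem isOpenMap_proj : IsOpenMap (proj Γ) := isOpenMap_quotient_mk'_mul

theorem finite_setOf_dist_smul_le (z w : ℍ) (r : ℝ) : {g : Γ | dist z (g • w) ≤ r}.Finite := by
  refine ((properlyDiscontinuousSMul_SL2Z Γ).finite_disjoint_inter_image
    (isCompact_singleton (x := w)) (isCompact_closedBall z r)).subset fun g hg => ?_
  have hmem : g • w ∈ Metric.closedBall z r := by
    rw [Metric.mem_closedBall, dist_comm]; exact hg
  exact ⟨g • w, Set.mem_image_of_mem _ rfl, hmem⟩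

/-- The distance to a point of the quotient is attained at a lift. -/
theorem exists_dist_eq (z : ℍ) (q : HypQuotient Γ) :
    ∃ w, proj Γ w = q ∧ dist z w = dist (proj Γ z) q := by
  obtain ⟨w₀, rfl⟩ := proj_surjective q
  set r := dist (proj Γ z) (proj Γ w₀)
  have hfin := finite_setOf_dist_smul_le (Γ := Γ) z w₀ (r + 1)
  have hex : ∀ e > 0, ∃ g : Γ, dist z (g • w₀) < r + e := fun e he => by
    obtain ⟨w, hw, hlt⟩ := exists_dist_lt (Γ := Γ) (z := z) (q := proj Γ w₀) (r := r + e)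
      (lt_add_of_pos_right _ he)
    obtain ⟨g, rfl⟩ := proj_eq_iff.1 hw
    exact ⟨g, hlt⟩
  obtain ⟨g₁, hg₁⟩ := hex 1 one_pos
  obtain ⟨g, hg, hmin⟩ := Set.exists_min_image _ (fun g : Γ => dist z (g • w₀)) hfin ⟨g₁, hg₁.le⟩
  refine ⟨g • w₀, proj_smul g w₀, le_antisymm (le_of_forall_pos_le_add fun e he => ?_) ?_⟩
  · obtain ⟨g', hg'⟩ := hex e he
    by_cases h : dist z (g' • w₀) ≤ r + 1
    · exact (hmin g' h).trans hg'.le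
    · exact hg.trans (not_le.1 h |>.le.trans hg'.le)
  · exact (congrArg (dist (proj Γ z)) (proj_smul g w₀)).ge.trans (dist_proj_le _ _)

/-- If `Γ` acts freely, the projection is an isometry on small balls. -/
theorem exists_ball_dist_proj_eq (hΓ : ∀ g ∈ Γ, g ≠ 1 → ∀ z : ℍ, g • z ≠ z) (z : ℍ) :
    ∃ ε > 0, ∀ u ∈ Metric.ball z ε, ∀ v ∈ Metric.ball z ε,
      dist (proj Γ u) (proj Γ v) = dist u v := by
  -- With displacement at least 4ε, a nontrivial translate of `v` is at least 2ε from `u`, farther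
  -- than `v` itself.
  obtain ⟨ε, hε, h⟩ : ∃ ε > 0, ∀ g : Γ, g ≠ 1 → 4 * ε ≤ dist z (g • z) := by
    have hfin := (finite_setOf_dist_smul_le (Γ := Γ) z z 1).subset
      (t := {g : Γ | g ≠ 1 ∧ dist z (g • z) ≤ 1}) fun g hg => hg.2
    rcases Set.eq_empty_or_nonempty {g : Γ | g ≠ 1 ∧ dist z (g • z) ≤ 1} with he | hne
    · refine ⟨1 / 4, by norm_num, fun g hg => ?_⟩
      by_contra! hlt
      have : g ∈ {g : Γ | g ≠ 1 ∧ dist z (g • z) ≤ 1} := ⟨hg, by linarith⟩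
      rw [he] at this
      exact this
    · obtain ⟨g₀, hg₀, hmin⟩ := Set.exists_min_image _ (fun g : Γ => dist z (g • z)) hfin hne
      have hpos : 0 < dist z (g₀ • z) :=
        dist_pos.2 (hΓ g₀ g₀.2 (fun h => hg₀.1 (Subtype.ext h)) z).symm
      refine ⟨dist z (g₀ • z) / 4, by linarith, fun g hg => ?_⟩
      by_cases h : dist z (g • z) ≤ 1
      · linarith [hmin g ⟨hg, h⟩]
      · linarith [hg₀.2]
  refine ⟨ε, hε, fun u hu v hv => le_antisymm (dist_proj_le _ _) ?_⟩
  obtain ⟨w, hw, hd⟩ := exists_dist_eq (Γ := Γ) u (proj Γ v)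
  obtain ⟨g, rfl⟩ := proj_eq_iff.1 hw
  rw [← hd]
  by_cases hg : g = 1
  · rw [hg, one_smul]
  · have h1 := h g hg
    have h2 := dist_triangle4 z u (g • v) (g • z)
    rw [dist_smul_smul] at h2
    have h3 := dist_triangle_right u v z
    rw [Metric.mem_ball] at hu hv
    rw [dist_comm] at hu
    rw [dist_comm u z] at h3
    linarith

/-- Local inverses of the projection that preserve distances. -/
def distCharts (Γ : Subgroup SL(2, ℤ)) : Set (OpenPartialHomeomorph (HypQuotient Γ) ℍ) :=
  {e | (∀ x ∈ e.source, proj Γ (e x) = x) ∧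
    ∀ x ∈ e.source, ∀ y ∈ e.source, dist (e x) (e y) = dist x y}

theorem distCharts_symm_apply {e : OpenPartialHomeomorph (HypQuotient Γ) ℍ}
    (he : e ∈ distCharts Γ) {w : ℍ} (hw : w ∈ e.target) : e.symm w = proj Γ w := by
  rw [← he.1 _ (e.map_target hw), e.right_inv hw]

theorem exists_distChart (hΓ : ∀ g ∈ Γ, g ≠ 1 → ∀ z : ℍ, g • z ≠ z) (x : HypQuotient Γ) :
    ∃ e ∈ distCharts Γ, x ∈ e.source := by
  obtain ⟨z, rfl⟩ := proj_surjective x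
  obtain ⟨ε, hε, h⟩ := exists_ball_dist_proj_eq hΓ z
  have hinj : Set.InjOn (proj Γ) (Metric.ball z ε) := fun u hu v hv huv => by
    rw [← dist_eq_zero, ← h u hu v hv, huv, dist_self]
  let e : OpenPartialHomeomorph ℍ (HypQuotient Γ) :=
    OpenPartialHomeomorph.ofContinuousOpen (hinj.toPartialEquiv _ _) continuous_proj.continuousOn
      isOpenMap_proj Metric.isOpen_ball
  refine ⟨e.symm, ⟨fun x hx => ?_, fun x hx y hy => ?_⟩, ?_⟩
  · exact e.right_inv hx
  · have hx' : e.symm x ∈ Metric.ball z ε := e.map_target hx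
    have hy' : e.symm y ∈ Metric.ball z ε := e.map_target hy
    rw [← h _ hx' _ hy']
    exact congrArg₂ dist (e.right_inv hx) (e.right_inv hy)
  · exact e.map_source (x := z) (Metric.mem_ball_self hε)

/-- Two local sections of the projection differ at a point by an element of `Γ`, and by continuity
the same element works nearby. -/
theorem distCharts_transition {e e' : OpenPartialHomeomorph (HypQuotient Γ) ℍ}
    (he : e ∈ distCharts Γ) (he' : e' ∈ distCharts Γ) {z : ℍ}
    (hz : z ∈ (e.symm.trans e').source) :
    ∃ g : ℍ ≃ᵢ ℍ, ∀ᶠ w in 𝓝 z, (e.symm.trans e') w = g w := by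
  have hz1 : z ∈ e.target := by simpa using hz.1
  have hz2 : e.symm z ∈ e'.source := hz.2
  have h1 : e.symm z = proj Γ z := distCharts_symm_apply he hz1
  obtain ⟨g, hg⟩ := proj_eq_iff.1 ((he'.1 _ hz2).trans h1)
  refine ⟨IsometryEquiv.constSMul
    (Matrix.SpecialLinearGroup.map (Int.castRingHom ℝ) (g : SL(2, ℤ))), ?_⟩
  have hmem : g • z ∈ e'.target := by rw [hg]; exact e'.map_source hz2
  have hev : ∀ᶠ w in 𝓝 z, g • w ∈ e'.target :=
    (continuous_const_smul g).continuousAt.eventually (e'.open_target.mem_nhds hmem)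
  filter_upwards [hev, e.open_target.mem_nhds hz1] with w hw hw'
  change e' (e.symm w) = g • w
  rw [distCharts_symm_apply he hw', ← proj_smul g w, ← distCharts_symm_apply he' hw,
    e'.right_inv hw]

instance properSpace : ProperSpace (HypQuotient Γ) where
  isCompact_closedBall p r := by
    obtain ⟨z, rfl⟩ := proj_surjective p
    refine ((isCompact_closedBall z r).image continuous_proj).of_isClosed_subset
      Metric.isClosed_closedBall fun q hq => ?_
    obtain ⟨w, hw, hd⟩ := exists_dist_eq (Γ := Γ) z q
    rw [Metric.mem_closedBall, dist_comm] at hq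
    exact ⟨w, by rw [Metric.mem_closedBall, dist_comm, hd]; exact hq, hw⟩

/-- Project a geodesic between closest lifts. The projection does not increase distances and keeps
that of the endpoints, so the triangle inequality leaves no room for shortening. -/
theorem exists_segment (p q : HypQuotient Γ) : ∃ c : ℝ → HypQuotient Γ, c 0 = p ∧
    c (dist p q) = q ∧ ∀ s ∈ Set.Icc 0 (dist p q), ∀ t ∈ Set.Icc 0 (dist p q),
      dist (c s) (c t) = |s - t| := by
  obtain ⟨z, rfl⟩ := proj_surjective p
  obtain ⟨w, rfl, hd⟩ := exists_dist_eq (Γ := Γ) z q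
  obtain ⟨c, hc, h0, h1⟩ := UpperHalfPlane.exists_isometry_through z w
  rw [← hd]
  have hle : ∀ s t, dist (proj Γ (c s)) (proj Γ (c t)) ≤ |s - t| := fun s t =>
    (dist_proj_le _ _).trans (hc.dist_eq s t).le
  have key : ∀ s ∈ Set.Icc 0 (dist z w), ∀ t ∈ Set.Icc 0 (dist z w), s ≤ t →
      dist (proj Γ (c s)) (proj Γ (c t)) = t - s := fun s hs t ht hst => by
    have h2 := dist_triangle4 (proj Γ (c 0)) (proj Γ (c s)) (proj Γ (c t)) (proj Γ (c (dist z w)))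
    have h3 := hle 0 s
    have h4 := hle s t
    have h5 := hle t (dist z w)
    rw [abs_of_nonpos (by linarith [hs.1])] at h3
    rw [abs_of_nonpos (by linarith)] at h4
    rw [abs_of_nonpos (by linarith [ht.2])] at h5
    rw [h0, h1, ← hd] at h2
    rw [h0] at h3
    rw [h1] at h5
    linarith
  refine ⟨fun s => proj Γ (c s), by simp only [h0], by simp only [h1], fun s hs t ht => ?_⟩
  rcases le_total s t with h | h
  · rw [key s hs t ht h, abs_of_nonpos (by linarith)]; ring
  · rw [dist_comm, key t ht s hs h, abs_of_nonneg (by linarith)]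

theorem isHyperbolicSurface (hΓ : ∀ g ∈ Γ, g ≠ 1 → ∀ z : ℍ, g • z ≠ z) :
    IsHyperbolicSurface (HypQuotient Γ) where
  t2 := t2Space_of_properlyDiscontinuousSMul_of_t2Space
  secondCountable := ContinuousConstSMul.secondCountableTopology
  connected := Quotient.instConnectedSpace
  complete := inferInstance
  exists_segment := exists_segment
  exists_atlas := ⟨distCharts Γ, exists_distChart hΓ, fun _ he => he.2,
    fun _ he _ he' _ hz => distCharts_transition he he' hz⟩

/-- The orbit of i stays at height at most 1, whereas the imaginary axis climbs arbitrarily high;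
the difference of log heights bounds distance from below. -/
theorem not_compactSpace (Γ : Subgroup SL(2, ℤ)) : ¬ CompactSpace (HypQuotient Γ) := by
  intro hcpt
  obtain ⟨C, hC⟩ := Metric.isBounded_iff.1 (isCompact_univ (X := HypQuotient Γ)).isBounded
  have hC0 : 0 ≤ C := dist_nonneg.trans
    (hC (Set.mem_univ (proj Γ UpperHalfPlane.I)) (Set.mem_univ (proj Γ UpperHalfPlane.I)))
  let z : ℍ := UpperHalfPlane.mk ⟨0, Real.exp (C + 1)⟩ (Real.exp_pos _)
  obtain ⟨w, hw, hd⟩ := exists_dist_eq (Γ := Γ) z (proj Γ UpperHalfPlane.I)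
  obtain ⟨g, rfl⟩ := proj_eq_iff.1 hw
  have hb := hC (Set.mem_univ (proj Γ z)) (Set.mem_univ (proj Γ UpperHalfPlane.I))
  rw [← hd] at hb
  have hlog := (UpperHalfPlane.dist_log_im_le z (g • UpperHalfPlane.I)).trans hb
  have him : (g • UpperHalfPlane.I).im ≤ 1 := by
    have h1 : (g • UpperHalfPlane.I).im = _ :=
      ModularGroup.im_smul_eq_div_normSq (g : SL(2, ℤ)) UpperHalfPlane.I
    have hdet : (g : SL(2, ℤ)) 0 0 * (g : SL(2, ℤ)) 1 1 - (g : SL(2, ℤ)) 0 1 * (g : SL(2, ℤ)) 1 0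
        = 1 := by
      have := (g : SL(2, ℤ)).det_coe; rwa [Matrix.det_fin_two] at this
    have h2 : Complex.normSq (UpperHalfPlane.denom (g : SL(2, ℤ)) UpperHalfPlane.I) =
        (((g : SL(2, ℤ)) 1 1 ^ 2 + (g : SL(2, ℤ)) 1 0 ^ 2 : ℤ) : ℝ) := by
      rw [ModularGroup.denom_apply, Complex.normSq_apply]
      simp
      ring
    have h3 : 1 ≤ (g : SL(2, ℤ)) 1 1 ^ 2 + (g : SL(2, ℤ)) 1 0 ^ 2 := by
      by_contra! hlt
      have e1 : (g : SL(2, ℤ)) 1 1 = 0 := by nlinarith [sq_nonneg ((g : SL(2, ℤ)) 1 0)]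
      have e2 : (g : SL(2, ℤ)) 1 0 = 0 := by nlinarith
      rw [e1, e2] at hdet
      simp at hdet
    have h4 : (1 : ℝ) ≤ (((g : SL(2, ℤ)) 1 1 ^ 2 + (g : SL(2, ℤ)) 1 0 ^ 2 : ℤ) : ℝ) := by
      exact_mod_cast h3
    rw [h1, h2, UpperHalfPlane.I_im]
    exact div_le_one_of_le₀ h4 (by linarith)
  have hl0 := Real.log_nonpos (g • UpperHalfPlane.I).im_pos.le him
  have hz : Real.log z.im = C + 1 := Real.log_exp _
  rw [Real.dist_eq, hz] at hlog
  linarith [le_abs_self (C + 1 - Real.log (g • UpperHalfPlane.I).im)]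

theorem isQuotientCoveringMap_proj (hΓ : ∀ g ∈ Γ, g ≠ 1 → ∀ z : ℍ, g • z ≠ z) :
    IsQuotientCoveringMap (proj Γ) Γ := by
  have : IsCancelSMul Γ ℍ := isCancelSMul_iff_eq_one_of_smul_eq.2 fun g z h => by
    by_contra hg
    exact hΓ g g.2 (fun h' => hg (Subtype.ext h')) z h
  exact isQuotientCoveringMap_quotientMk_of_properlyDiscontinuousSMul

end HypQuotient

/-! ### Closed geodesics in the quotient -/

/-- `c` is a geodesic of `ℍ`, parametrized by arc length, in the local sense. -/
def IsLocalGeodesic (c : ℝ → ℍ) : Prop :=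
  ∀ t : ℝ, ∃ ε > 0, ∀ s ∈ Metric.ball t ε, ∀ s' ∈ Metric.ball t ε, dist (c s) (c s') = |s - s'|

namespace IsLocalGeodesic

variable {c : ℝ → ℍ}

theorem isometry_comp (hc : IsLocalGeodesic c) {f : ℍ → ℍ} (hf : Isometry f) :
    IsLocalGeodesic fun t => f (c t) := fun t => by
  obtain ⟨ε, hε, h⟩ := hc t
  exact ⟨ε, hε, fun s hs s' hs' => by rw [hf.dist_eq, h s hs s' hs']⟩

/-- Continuous induction: the times satisfying the bound form a closed set that can always be
extended to the right. -/
theorem dist_le (hc : IsLocalGeodesic c) (hcont : Continuous c) {L : ℝ} (hL : 0 ≤ L) :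
    dist (c 0) (c L) ≤ L := by
  have hsub : Set.Icc 0 L ⊆ {t | dist (c 0) (c t) ≤ t} := by
    apply IsClosed.Icc_subset_of_forall_mem_nhdsWithin
    · exact (isClosed_le (by fun_prop) (by fun_prop)).inter isClosed_Icc
    · simp
    · rintro t ⟨ht, -⟩
      obtain ⟨ε, hε, h⟩ := hc t
      have hmem : Set.Ioo t (t + ε) ∈ 𝓝[>] t := Ioo_mem_nhdsGT (by linarith)
      filter_upwards [hmem] with s hs
      have h1 := h t (Metric.mem_ball_self hε) s (by
        rw [Metric.mem_ball, Real.dist_eq, abs_of_pos (by linarith [hs.1])]; linarith [hs.2])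
      rw [abs_of_neg (by linarith [hs.1])] at h1
      have h2 := dist_triangle (c 0) (c t) (c s)
      have h3 : dist (c 0) (c t) ≤ t := ht
      change dist (c 0) (c s) ≤ s
      linarith
  exact hsub ⟨hL, le_rfl⟩

/-- The height along a geodesic is not periodic. -/
theorem not_periodic_im (hc : IsLocalGeodesic c) (hcont : Continuous c) {L : ℝ} (hL : 0 < L) :
    ¬ Function.Periodic (fun t => (c t).im) L := by
  intro hper
  have hcim : Continuous fun t => (c t).im := UpperHalfPlane.continuous_im.comp hcont
  obtain ⟨t, -, hmin⟩ := isCompact_Icc.exists_isMinOn (Set.nonempty_Icc.2 hL.le) hcim.continuousOn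
  have hmin' : ∀ s, (c t).im ≤ (c s).im := fun s => by
    obtain ⟨s', hs', he⟩ := hper.exists_mem_Ico₀ hL s
    have := hmin (Set.Ico_subset_Icc_self hs')
    exact this.trans he.ge
  obtain ⟨ε, hε, h⟩ := hc t
  have hm := Metric.mem_ball_self (x := t) hε
  have ha : t - ε / 2 ∈ Metric.ball t ε := by
    rw [Metric.mem_ball, Real.dist_eq, abs_of_neg (by linarith)]; linarith
  have hb : t + ε / 2 ∈ Metric.ball t ε := by
    rw [Metric.mem_ball, Real.dist_eq, abs_of_pos (by linarith)]; linarith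
  have h1 := h _ ha _ hm
  have h2 := h _ hm _ hb
  have h3 := h _ ha _ hb
  rw [abs_of_neg (by linarith)] at h1 h2 h3
  have := UpperHalfPlane.min_im_lt_im_midpoint (half_pos hε) (h1.trans (by ring))
    (h2.trans (by ring)) (h3.trans (by ring))
  rcases min_lt_iff.1 this with h | h
  · exact absurd (hmin' _) (not_le.2 h)
  · exact absurd (hmin' _) (not_le.2 h)

end IsLocalGeodesic

/-- A matrix with trace `±2` preserves the height of the points above some point at infinity. -/
theorem exists_im_smul_smul_eq_of_abs_trace_eq_two (g : SL(2, ℝ)) (h : |g 0 0 + g 1 1| = 2) :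
    ∃ p : SL(2, ℝ), ∀ z : ℍ, (p • g • z).im = (p • z).im := by
  have hdet : g 0 0 * g 1 1 - g 0 1 * g 1 0 = 1 := by
    have := g.det_coe; rwa [Matrix.det_fin_two] at this
  have h4 : (g 0 0 + g 1 1) ^ 2 = 4 := by rw [← sq_abs, h]; norm_num
  -- The height of `p • z` depends only on the bottom row of `p`, up to sign; a left eigenvector of
  -- `g` with eigenvalue ±1 is the right choice.
  suffices H : ∃ p : SL(2, ℝ), ∃ e : ℝ, e ^ 2 = 1 ∧ (p * g) 1 0 = e * p 1 0 ∧
      (p * g) 1 1 = e * p 1 1 by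
    obtain ⟨p, e, he, h0, h1⟩ := H
    refine ⟨p, fun z => ?_⟩
    rw [← mul_smul, UpperHalfPlane.im_SL2R_smul, UpperHalfPlane.im_SL2R_smul, h0, h1]
    congr 1
    have : ((e * p 1 0 : ℝ) : ℂ) * z + ((e * p 1 1 : ℝ) : ℂ) =
        (e : ℂ) * ((p 1 0 : ℂ) * z + p 1 1) := by
      push_cast; ring
    rw [this, Complex.normSq_mul, Complex.normSq_ofReal, ← sq, he, one_mul]
  have hrow : ∀ (p : SL(2, ℝ)) (j : Fin 2), (p * g) 1 j = p 1 0 * g 0 j + p 1 1 * g 1 j :=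
    fun p j => by
      rw [Matrix.SpecialLinearGroup.coe_mul, Matrix.mul_apply, Fin.sum_univ_two]
  by_cases hc : g 1 0 = 0
  · refine ⟨1, g 1 1, ?_, ?_, ?_⟩
    · rw [hc] at hdet
      nlinarith [sq_nonneg (g 0 0 - g 1 1)]
    · rw [hrow]; simp [hc]
    · rw [hrow]; simp
  · obtain ⟨p, hp0, hp1⟩ : ∃ p : SL(2, ℝ), p 1 0 = g 1 0 ∧ p 1 1 = (g 1 1 - g 0 0) / 2 :=
      ⟨⟨!![0, -1 / g 1 0; g 1 0, (g 1 1 - g 0 0) / 2], by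
        rw [Matrix.det_fin_two_of]; field_simp; ring⟩, rfl, rfl⟩
    refine ⟨p, (g 0 0 + g 1 1) / 2, ?_, ?_, ?_⟩
    · linear_combination h4 / 4
    · rw [hrow, hp0, hp1]; ring
    · rw [hrow, hp0, hp1]; linear_combination h4 / 4 - hdet

namespace HypQuotient

variable {Γ : Subgroup SL(2, ℤ)}

/-- A translation axis of an element of `Γ` projects to a closed geodesic. -/
theorem exists_isProjectedAxis (hΓ : ∀ g ∈ Γ, g ≠ 1 → ∀ z : ℍ, g • z ≠ z) {γ : SL(2, ℤ)}
    (hγ : γ ∈ Γ) {L : ℝ} (hL : 0 < L) {c : ℝ → ℍ} (hc : Isometry c)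
    (ht : ∀ t, γ • c t = c (t + L)) :
    ∃ α : C(AddCircle L, HypQuotient Γ), IsProjectedAxis γ α ∧ IsClosedGeodesic α := by
  have hper : Function.Periodic (fun t => proj Γ (c t)) L := fun t => by
    change proj Γ (c (t + L)) = proj Γ (c t)
    rw [← ht]
    exact proj_smul ⟨γ, hγ⟩ (c t)
  have hcont : Continuous hper.lift :=
    continuous_coinduced_dom.2 (continuous_proj.comp hc.continuous)
  refine ⟨⟨hper.lift, hcont⟩, ⟨c, hc, ht, fun t => rfl⟩, hL, fun t => ?_⟩
  obtain ⟨ε, hε, h⟩ := exists_ball_dist_proj_eq hΓ (c t)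
  refine ⟨ε, hε, fun s hs s' hs' => ?_⟩
  have hmem : ∀ s ∈ Metric.ball t ε, c s ∈ Metric.ball (c t) ε := fun s hs => by
    rwa [Metric.mem_ball, hc.dist_eq]
  change dist (proj Γ (c s)) (proj Γ (c s')) = _
  rw [h _ (hmem s hs) _ (hmem s' hs'), hc.dist_eq, Real.dist_eq]

/-- A closed curve that lifts to a curve translated by a nontrivial element is not contractible. -/
theorem not_nullhomotopic (hΓ : ∀ g ∈ Γ, g ≠ 1 → ∀ z : ℍ, g • z ≠ z) {γ : SL(2, ℤ)}
    (hγ : γ ∈ Γ) (hγ1 : γ ≠ 1) {L : ℝ} {α : C(AddCircle L, HypQuotient Γ)}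
    (hα : IsProjectedAxis γ α) : ¬ α.Nullhomotopic := by
  rintro ⟨y, ⟨F⟩⟩
  obtain ⟨c, hc, ht, hαc⟩ := hα
  have cov := (isQuotientCoveringMap_proj hΓ).isCoveringMap
  let H : C(unitInterval × ℝ, HypQuotient Γ) :=
    ⟨fun p => F (p.1, (p.2 : AddCircle L)), F.continuous.comp
      (continuous_fst.prodMk ((AddCircle.continuous_mk' L).comp continuous_snd))⟩
  have H0 : ∀ t : ℝ, H (0, t) = proj Γ (c t) := fun t => (F.apply_zero _).trans (hαc t)
  have H1 : ∀ t : ℝ, H (1, t) = y := fun t => F.apply_one _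
  have Hper : ∀ s t, H (s, t + L) = H (s, t) := fun s t => by simp [H]
  let K := cov.liftHomotopy H ⟨c, hc.continuous⟩ H0
  have hK : ∀ p, proj Γ (K p) = H p := fun p => congrFun (cov.liftHomotopy_lifts H _ H0) p
  have hK0 : ∀ t, K (0, t) = c t := fun t => cov.liftHomotopy_zero H _ H0 t
  let γ' : Γ := ⟨γ, hγ⟩
  -- Both sides lift the same path and agree at time 0, where the lift is the axis.
  have hKγ : ∀ t, (fun s => K (s, t + L)) = fun s => γ' • K (s, t) := fun t =>
    cov.eq_of_comp_eq (by fun_prop) ((continuous_const_smul γ').comp (by fun_prop))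
      (funext fun s => by
        simp only [Function.comp_apply]
        rw [proj_smul, hK, hK, Hper]) 0 (by simp only [hK0]; exact (ht t).symm)
  -- At time 1 the curve is constant, hence so is its lift; combined with equivariance, `γ` fixes
  -- that point.
  have hK1 : ∀ t t', K (1, t) = K (1, t') := fun t t' =>
    cov.const_of_comp (g := fun t => K (1, t)) (by fun_prop)
      (fun a a' => by rw [hK, hK, H1, H1]) t t'
  refine hΓ γ hγ hγ1 (K (1, 0)) ?_
  have := congrFun (hKγ 0) 1
  exact this.symm.trans (hK1 _ _)

/-- A closed geodesic lifts to a geodesic of `ℍ` translated by an element of `Γ`. -/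
theorem exists_lift_of_isClosedGeodesic (hΓ : ∀ g ∈ Γ, g ≠ 1 → ∀ z : ℍ, g • z ≠ z) {L : ℝ}
    {α : C(AddCircle L, HypQuotient Γ)} (hα : IsClosedGeodesic α) :
    ∃ γ ∈ Γ, ∃ c : ℝ → ℍ, Continuous c ∧ IsLocalGeodesic c ∧ ∀ t, γ • c t = c (t + L) := by
  have cov := (isQuotientCoveringMap_proj hΓ).isCoveringMap
  let f : C(ℝ, HypQuotient Γ) := ⟨fun t => α (t : AddCircle L), by fun_prop⟩
  obtain ⟨z₀, hz₀⟩ := proj_surjective (f 0)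
  obtain ⟨c, ⟨-, hc⟩, -⟩ := cov.existsUnique_continuousMap_lifts f 0 z₀ hz₀
  have hc' : ∀ t, proj Γ (c t) = α (t : AddCircle L) := fun t => congrFun hc t
  have hper : ∀ t, proj Γ (c (t + L)) = proj Γ (c t) := fun t => by
    rw [hc', hc']; simp
  obtain ⟨g, hg⟩ := proj_eq_iff.1 (hper 0)
  refine ⟨g, g.2, c, c.continuous, fun t => ?_, fun t => ?_⟩
  · obtain ⟨ε₁, hε₁, h₁⟩ := hα.2 t
    obtain ⟨ε₂, hε₂, h₂⟩ := exists_ball_dist_proj_eq hΓ (c t)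
    obtain ⟨δ, hδ, hδ'⟩ := Metric.continuous_iff.1 c.continuous t ε₂ hε₂
    refine ⟨min ε₁ δ, lt_min hε₁ hδ, fun s hs s' hs' => ?_⟩
    rw [Metric.mem_ball, lt_min_iff] at hs hs'
    rw [← h₂ _ (hδ' s hs.2) _ (hδ' s' hs'.2), hc', hc', h₁ s hs.1 s' hs'.1]
  · have := cov.eq_of_comp_eq (g₁ := fun t => g • c t) (g₂ := fun t => c (t + L))
      ((continuous_const_smul g).comp c.continuous) (by fun_prop)
      (funext fun s => by
        simp only [Function.comp_apply]
        rw [proj_smul, hper]) 0 hg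
    exact congrFun this t

/-- Every closed geodesic of `Γ \ ℍ` is at least as long as the translation length prescribed by the
trace of some element of `Γ` that is neither parabolic nor trivial. -/
theorem exists_trace_of_isClosedGeodesic (hΓ : ∀ g ∈ Γ, g ≠ 1 → ∀ z : ℍ, g • z ≠ z) {L : ℝ}
    {α : C(AddCircle L, HypQuotient Γ)} (hα : IsClosedGeodesic α) :
    ∃ γ ∈ Γ, |(γ : Matrix (Fin 2) (Fin 2) ℤ).trace| ≠ 2 ∧
      (|(γ : Matrix (Fin 2) (Fin 2) ℤ).trace| : ℝ) ≤ 2 * Real.cosh (L / 2) := by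
  obtain ⟨γ, hγ, c, hcont, hc, ht⟩ := exists_lift_of_isClosedGeodesic hΓ hα
  set g := Matrix.SpecialLinearGroup.map (Int.castRingHom ℝ) γ with hg
  have htr : g 0 0 + g 1 1 = ((γ : Matrix (Fin 2) (Fin 2) ℤ).trace : ℝ) := by
    rw [Matrix.trace_fin_two]; push_cast; rfl
  refine ⟨γ, hγ, fun h2 => ?_, ?_⟩
  -- This excludes parabolic elements and ±1 at once: the height of `p • c` would be periodic.
  · obtain ⟨p, hp⟩ := exists_im_smul_smul_eq_of_abs_trace_eq_two g (by
      rw [htr]; exact_mod_cast h2)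
    refine (hc.isometry_comp (isometry_smul ℍ p)).not_periodic_im
      (hcont.const_smul p) hα.1 fun t => ?_
    change (p • c (t + L)).im = (p • c t).im
    rw [← ht, UpperHalfPlane.SL2Z_smul_eq, hp]
  · rw [← htr]
    refine (UpperHalfPlane.abs_trace_le_two_mul_cosh g (c 0)).trans ?_
    have h1 : g • c 0 = c L := by
      rw [hg, ← UpperHalfPlane.SL2Z_smul_eq, ht, zero_add]
    have hL := hα.1
    rw [h1]
    gcongr
    rw [Real.cosh_le_cosh, abs_of_nonneg (by positivity), abs_of_nonneg (by positivity)]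
    linarith [hc.dist_le hcont hL.le]

end HypQuotient

/-! ### Principal congruence subgroups -/

theorem SL2Z_det_eq (g : SL(2, ℤ)) : g 0 0 * g 1 1 - g 0 1 * g 1 0 = 1 := by
  have := g.det_coe; rwa [Matrix.det_fin_two] at this

theorem SL2Z_map_apply (g : SL(2, ℤ)) (i j : Fin 2) :
    Matrix.SpecialLinearGroup.map (Int.castRingHom ℝ) g i j = (g i j : ℝ) := rfl

namespace CongruenceSubgroup

/-- For γ = 1 + N M, det γ = 1 reads N tr M + N² det M = 0; here k = det M. -/
theorem exists_trace_eq_of_mem_Gamma {N : ℕ} {γ : SL(2, ℤ)} (hγ : γ ∈ Gamma N) :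
    ∃ k : ℤ, (γ : Matrix (Fin 2) (Fin 2) ℤ).trace = 2 - N ^ 2 * k := by
  have hdet := SL2Z_det_eq γ
  rw [Gamma_mem] at hγ
  obtain ⟨h00, h01, h10, h11⟩ := hγ
  obtain ⟨a, ha⟩ := (ZMod.intCast_eq_intCast_iff_dvd_sub 1 (γ 0 0) N).1 (by simpa using h00.symm)
  obtain ⟨d, hd⟩ := (ZMod.intCast_eq_intCast_iff_dvd_sub 1 (γ 1 1) N).1 (by simpa using h11.symm)
  obtain ⟨b, hb⟩ := (ZMod.intCast_zmod_eq_zero_iff_dvd (γ 0 1) N).1 h01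
  obtain ⟨c, hc⟩ := (ZMod.intCast_zmod_eq_zero_iff_dvd (γ 1 0) N).1 h10
  refine ⟨a * d - b * c, ?_⟩
  rw [Matrix.trace_fin_two]
  rw [hb, hc, eq_add_of_sub_eq ha, eq_add_of_sub_eq hd] at hdet
  rw [eq_add_of_sub_eq ha, eq_add_of_sub_eq hd]
  linear_combination hdet

theorem le_abs_trace_of_mem_Gamma {N : ℕ} {γ : SL(2, ℤ)} (hγ : γ ∈ Gamma N)
    (h : |(γ : Matrix (Fin 2) (Fin 2) ℤ).trace| ≠ 2) :
    (N : ℤ) ^ 2 - 2 ≤ |(γ : Matrix (Fin 2) (Fin 2) ℤ).trace| := by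
  obtain ⟨k, hk⟩ := exists_trace_eq_of_mem_Gamma hγ
  rw [hk] at h ⊢
  have hk0 : k ≠ 0 := by rintro rfl; simp at h
  have hN2 : 0 ≤ (N : ℤ) ^ 2 := sq_nonneg _
  rcases lt_or_gt_of_ne hk0 with hlt | hgt
  · exact le_trans (by nlinarith) (le_abs_self _)
  · exact le_trans (by nlinarith) (neg_le_abs _)

theorem smul_ne_of_mem_Gamma {N : ℕ} (hN : 3 ≤ N) {γ : SL(2, ℤ)} (hγ : γ ∈ Gamma N)
    (h1 : γ ≠ 1) (z : ℍ) : γ • z ≠ z := by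
  intro hz
  have hN9 : (9 : ℤ) ≤ (N : ℤ) ^ 2 := by
    have : (3 : ℤ) ≤ N := by exact_mod_cast hN
    nlinarith
  have h2 : 2 ≤ |(γ : Matrix (Fin 2) (Fin 2) ℤ).trace| := by
    by_cases h : |(γ : Matrix (Fin 2) (Fin 2) ℤ).trace| = 2
    · exact h.ge
    · linarith [le_abs_trace_of_mem_Gamma hγ h]
  obtain ⟨hc, hb, had⟩ := UpperHalfPlane.eq_of_smul_eq_of_two_le_abs_trace
    (Matrix.SpecialLinearGroup.map (Int.castRingHom ℝ) γ) z hz (by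
      rw [Matrix.trace_fin_two] at h2
      rw [SL2Z_map_apply, SL2Z_map_apply]
      exact_mod_cast h2)
  simp only [SL2Z_map_apply] at hc hb had
  replace hc : γ 1 0 = 0 := by exact_mod_cast hc
  replace hb : γ 0 1 = 0 := by exact_mod_cast hb
  replace had : γ 0 0 = γ 1 1 := by exact_mod_cast had
  have hdet := SL2Z_det_eq γ
  rw [hc, hb, had, mul_zero, sub_zero] at hdet
  rcases mul_self_eq_one_iff.1 hdet with h | h
  · refine h1 (Matrix.SpecialLinearGroup.ext _ _ fun i j => ?_)
    fin_cases i <;> fin_cases j <;> simp [hc, hb, had, h]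
  -- The remaining case γ = -1 would give N² k = 4, impossible for N ≥ 3.
  · obtain ⟨k, hk⟩ := exists_trace_eq_of_mem_Gamma hγ
    rw [Matrix.trace_fin_two, had, h] at hk
    have hk4 : (N : ℤ) ^ 2 * k = 4 := by linarith
    have : 0 < k := by nlinarith
    nlinarith

theorem SL2Z_apply_one_zero_ne_zero {g : SL(2, ℤ)}
    (h : 2 < |(g : Matrix (Fin 2) (Fin 2) ℤ).trace|) : g 1 0 ≠ 0 := by
  intro hc
  have hdet := SL2Z_det_eq g
  rw [hc, mul_zero, sub_zero] at hdet
  rw [Matrix.trace_fin_two] at h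
  rcases Int.eq_one_or_neg_one_of_mul_eq_one' hdet with ⟨h0, h1⟩ | ⟨h0, h1⟩ <;>
    simp [h0, h1] at h

/-- Cayley–Hamilton for determinant one. -/
theorem neg_sq_apply (β : SL(2, ℤ)) (i j : Fin 2) : (-(β ^ 2)) i j =
    (1 : Matrix (Fin 2) (Fin 2) ℤ) i j - (β : Matrix (Fin 2) (Fin 2) ℤ).trace * β i j := by
  have hdet := SL2Z_det_eq β
  rw [Matrix.trace_fin_two, Matrix.SpecialLinearGroup.coe_neg, Matrix.SpecialLinearGroup.coe_pow,
    sq, Matrix.neg_apply, Matrix.mul_apply, Fin.sum_univ_two]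
  fin_cases i <;> fin_cases j <;> simp
  · linear_combination hdet
  · ring
  · ring
  · linear_combination hdet

theorem neg_sq_mem_Gamma {N : ℕ} {β : SL(2, ℤ)}
    (h : (N : ℤ) ∣ (β : Matrix (Fin 2) (Fin 2) ℤ).trace) : -(β ^ 2) ∈ Gamma N := by
  have h0 := (ZMod.intCast_zmod_eq_zero_iff_dvd _ N).2 h
  rw [Gamma_mem]
  refine ⟨?_, ?_, ?_, ?_⟩ <;> rw [neg_sq_apply] <;> push_cast <;> rw [h0] <;> simp

theorem trace_neg_sq (β : SL(2, ℤ)) : ((-(β ^ 2) : SL(2, ℤ)) : Matrix (Fin 2) (Fin 2) ℤ).trace =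
    2 - (β : Matrix (Fin 2) (Fin 2) ℤ).trace ^ 2 := by
  rw [Matrix.trace_fin_two, neg_sq_apply, neg_sq_apply, Matrix.trace_fin_two]
  simp
  ring

/-- An element of `Γ(N)` with `|tr| = N² - 2` represents a systole. -/
theorem representsSystole_of_abs_trace_eq {N : ℕ} (hN : 3 ≤ N) {γ : SL(2, ℤ)}
    (hγ : γ ∈ Gamma N) (h : |(γ : Matrix (Fin 2) (Fin 2) ℤ).trace| = (N : ℤ) ^ 2 - 2) :
    RepresentsSystole (Gamma N) γ := by
  have hΓ : ∀ g ∈ Gamma N, g ≠ 1 → ∀ z : ℍ, g • z ≠ z :=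
    fun g hg h1 z => smul_ne_of_mem_Gamma hN hg h1 z
  have hN9 : (9 : ℤ) ≤ (N : ℤ) ^ 2 := by
    have : (3 : ℤ) ≤ N := by exact_mod_cast hN
    nlinarith
  have h2 : 2 < |(γ : Matrix (Fin 2) (Fin 2) ℤ).trace| := by linarith
  have hγ1 : γ ≠ 1 := by
    rintro rfl
    simp at h2
  set g := Matrix.SpecialLinearGroup.map (Int.castRingHom ℝ) γ with hg
  have htr : g 0 0 + g 1 1 = ((γ : Matrix (Fin 2) (Fin 2) ℤ).trace : ℝ) := by
    rw [Matrix.trace_fin_two]; push_cast; rfl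
  have hg10 : g 1 0 ≠ 0 := by
    have := SL2Z_apply_one_zero_ne_zero h2
    rw [hg, SL2Z_map_apply]
    exact_mod_cast this
  obtain ⟨L, c, hL, hcosh, hc, ht⟩ := UpperHalfPlane.exists_axis g hg10 (by
    rw [htr]; exact_mod_cast h2)
  obtain ⟨α, hα, hα'⟩ := HypQuotient.exists_isProjectedAxis hΓ hγ hL hc ht
  have hnull := HypQuotient.not_nullhomotopic hΓ hγ hγ1 hα
  have hleast : IsLeast {L : ℝ | ∃ α : C(AddCircle L, HypQuotient (Gamma N)),
      IsClosedGeodesic α ∧ ¬ α.Nullhomotopic} L := by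
    refine ⟨⟨α, hα', hnull⟩, ?_⟩
    rintro L' ⟨α', hgeo, -⟩
    obtain ⟨γ', hγ', hne, hle⟩ := HypQuotient.exists_trace_of_isClosedGeodesic hΓ hgeo
    have h3 := le_abs_trace_of_mem_Gamma hγ' hne
    rw [← h] at h3
    have h4 : (|(γ : Matrix (Fin 2) (Fin 2) ℤ).trace| : ℝ) ≤
        (|(γ' : Matrix (Fin 2) (Fin 2) ℤ).trace| : ℝ) := by exact_mod_cast h3
    rw [htr] at hcosh
    have h5 : Real.cosh (L / 2) ≤ Real.cosh (L' / 2) := by linarith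
    have hL' := hgeo.1
    rw [Real.cosh_le_cosh, abs_of_pos (by positivity), abs_of_pos (by positivity)] at h5
    linarith
  exact ⟨hγ, L, α, hα, hα', hnull, hleast.csInf_eq.symm⟩

end CongruenceSubgroup

/-! ### Fundamental domains and areas -/

open MeasureTheory Pointwise

section Subgroup

variable {P α : Type*} [Group P] [MulAction P α] [MeasurableSpace α] {μ : Measure α}
  {G H : Subgroup P} {s : Set α}

/-- The union of the translates of a set by inverses of representatives of the left cosets of `H`
in `G`. -/
noncomputable def cosetTranslates (G H : Subgroup P) (s : Set α) : Set α :=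
  ⋃ q : G ⧸ H.subgroupOf G, (q.out)⁻¹ • s

/-- `G` is the disjoint union of the left cosets q H; taking inverses, it is the disjoint union of
the H q⁻¹, so the `H`-translates of the union are the `G`-translates of `s`. -/
theorem MeasureTheory.IsFundamentalDomain.cosetTranslates [MeasurableConstSMul G α]
    [SMulInvariantMeasure G α μ] [Countable G] (hs : IsFundamentalDomain G s μ) (hHG : H ≤ G) :
    IsFundamentalDomain H (cosetTranslates G H s) μ := by
  have : Countable (G ⧸ H.subgroupOf G) := Function.Surjective.countable QuotientGroup.mk_surjective
  exact
  { nullMeasurableSet := NullMeasurableSet.iUnion fun q => hs.nullMeasurableSet_smul _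
    ae_covers := by
      filter_upwards [hs.ae_covers] with x ⟨g, hg⟩
      obtain ⟨h, hh⟩ := QuotientGroup.mk_out_eq_mul (H.subgroupOf G) g
      refine ⟨⟨(h⁻¹ : G), inv_mem (Subgroup.mem_subgroupOf.1 h.2)⟩, Set.mem_iUnion.2 ⟨(g : G ⧸ H.subgroupOf G), ?_⟩⟩
      rw [Set.mem_smul_set_iff_inv_smul_mem, inv_inv, hh]
      change (g * (h : G)) • ((h : G)⁻¹ • x) ∈ s
      rwa [smul_smul, mul_inv_cancel_right]
    aedisjoint := by
      intro h h' hne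
      simp only [Function.onFun, _root_.cosetTranslates, Set.smul_set_iUnion]
      refine AEDisjoint.iUnion_left_iff.2 fun q => AEDisjoint.iUnion_right_iff.2 fun q' => ?_
      let k : G := ⟨h, hHG h.2⟩
      let k' : G := ⟨h', hHG h'.2⟩
      change AEDisjoint μ (k • (q.out⁻¹ • s)) (k' • (q'.out⁻¹ • s))
      rw [smul_smul, smul_smul]
      refine hs.aedisjoint fun heq => hne ?_
      have heq' : q.out * k⁻¹ = q'.out * k'⁻¹ := by
        have := congrArg (·⁻¹) heq
        simpa using this
      have hk : k⁻¹ ∈ H.subgroupOf G := inv_mem (Subgroup.mem_subgroupOf.2 h.2)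
      have hk' : k'⁻¹ ∈ H.subgroupOf G := inv_mem (Subgroup.mem_subgroupOf.2 h'.2)
      have hq : q = q' := by
        have := congrArg (QuotientGroup.mk (s := H.subgroupOf G)) heq'
        rwa [QuotientGroup.mk_mul_of_mem _ hk, QuotientGroup.mk_mul_of_mem _ hk',
          QuotientGroup.out_eq', QuotientGroup.out_eq'] at this
      subst hq
      have : k = k' := inv_injective (mul_left_cancel heq')
      exact Subtype.ext (congrArg (fun x : G => (x : P)) this) }

theorem measure_cosetTranslates_le [SMulInvariantMeasure G α μ] [MeasurableConstSMul G α]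
    [Finite (G ⧸ H.subgroupOf G)] :
    μ (cosetTranslates G H s) ≤ H.relIndex G * μ s := by
  have := Fintype.ofFinite (G ⧸ H.subgroupOf G)
  refine (measure_iUnion_le _).trans ?_
  simp only [measure_smul]
  rw [tsum_fintype, Finset.sum_const, Finset.card_univ, nsmul_eq_mul, Subgroup.relIndex,
    Subgroup.index, Nat.card_eq_fintype_card]

end Subgroup

section TransformationGroup

variable (Γ : Subgroup SL(2, ℤ))

theorem transformationGroup_eq_map :
    transformationGroup Γ = Γ.map (MulAction.toPermHom SL(2, ℤ) ℍ) := by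
  ext g
  constructor
  · rintro ⟨γ, rfl⟩
    exact ⟨γ, γ.2, rfl⟩
  · rintro ⟨γ, hγ, rfl⟩
    exact ⟨⟨γ, hγ⟩, rfl⟩

instance countable_SL2Z : Countable SL(2, ℤ) :=
  Function.Injective.countable (f := fun (g : SL(2, ℤ)) (i j : Fin 2) => g i j)
    fun a b h => Matrix.SpecialLinearGroup.ext a b fun i j => congrFun (congrFun h i) j

instance countable_transformationGroup : Countable (transformationGroup Γ) :=
  (MulAction.toPermHom Γ ℍ).rangeRestrict_surjective.countable

instance measurableConstSMul_transformationGroup :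
    MeasurableConstSMul (transformationGroup Γ) ℍ where
  measurable_const_smul := by
    rintro ⟨_, γ, rfl⟩
    exact (continuous_const_smul γ).measurable

instance smulInvariantMeasure_transformationGroup :
    SMulInvariantMeasure (transformationGroup Γ) ℍ volume where
  measure_preimage_smul := by
    rintro ⟨_, γ, rfl⟩ s hs
    exact measure_preimage_smul volume (Matrix.SpecialLinearGroup.mapGL ℝ (γ : SL(2, ℤ))) s

end TransformationGroup

/-! ### The modular fundamental domain and its area. -/

namespace ModularGroup

open UpperHalfPlane
open scoped Modular

theorem volume_eq_zero_of_coe_image {s : Set ℍ} (h : volume ((↑) '' s : Set ℂ) = 0) :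
    volume s = 0 := by
  rw [volume_eq_lintegral, Measure.restrict_eq_zero.2 h, lintegral_zero_measure]

theorem volume_fd_diff_fdo : volume (𝒟 \ 𝒟ᵒ) = 0 := by
  apply volume_eq_zero_of_coe_image
  have h1 : volume {z : ℂ | z.re = 1 / 2} = 0 := by
    rw [← Complex.frontier_setOfPred_re_le]
    exact (convex_halfSpace_re_le _).addHaar_frontier volume
  have h2 : volume {z : ℂ | z.re = -(1 / 2)} = 0 := by
    rw [← Complex.frontier_setOfPred_re_le]
    exact (convex_halfSpace_re_le _).addHaar_frontier volume
  have h3 : volume (Metric.sphere (0 : ℂ) 1) = 0 := Measure.addHaar_sphere _ _ _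
  refine measure_mono_null ?_ (measure_union_null (measure_union_null h1 h2) h3)
  rintro _ ⟨z, ⟨⟨hz1, hz2⟩, hz3⟩, rfl⟩
  by_cases hn : Complex.normSq z = 1
  · right
    rw [mem_sphere_zero_iff_norm]
    rw [Complex.normSq_eq_norm_sq] at hn
    exact (pow_eq_one_iff_of_nonneg (norm_nonneg _) two_ne_zero).1 hn
  · left
    have hre : |z.re| = 1 / 2 := by
      by_contra hre
      exact hz3 ⟨lt_of_le_of_ne hz1 (Ne.symm hn), lt_of_le_of_ne hz2 hre⟩
    exact eq_or_eq_neg_of_abs_eq hre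

/-- Passing to transformations removes -1, which acts trivially and would spoil disjointness. A
nontrivial translate meets `𝒟` only in the null set `𝒟 \ 𝒟ᵒ`. -/
theorem isFundamentalDomain_fd : IsFundamentalDomain (transformationGroup ⊤) 𝒟 := by
  refine IsFundamentalDomain.mk'' isClosed_fd.measurableSet.nullMeasurableSet
    (Filter.Eventually.of_forall fun z => ?_) ?_ fun g => (measurePreserving_smul g
      (volume : Measure ℍ)).quasiMeasurePreserving
  · obtain ⟨γ, hγ⟩ := exists_smul_mem_fd z
    exact ⟨⟨_, ⟨γ, Subgroup.mem_top γ⟩, rfl⟩, hγ⟩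
  · rintro g hg
    have hsub : g • 𝒟 ∩ 𝒟 ⊆ 𝒟 \ 𝒟ᵒ := fun z hz => ⟨hz.2, fun hzo => hg ?_⟩
    · exact measure_mono_null hsub volume_fd_diff_fdo
    rw [← inv_eq_one]
    have hz1 := Set.mem_smul_set_iff_inv_smul_mem.1 hz.1
    generalize g⁻¹ = k at hz1 ⊢
    obtain ⟨_, γ, rfl⟩ := k
    have h1 : (γ : SL(2, ℤ)) • z ∈ 𝒟 := hz1
    apply Subtype.ext
    ext1 w
    change (γ : SL(2, ℤ)) • w = w
    rcases eq_one_or_neg_one_of_mem_fdo_mem_fd hzo h1 with h | h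
    · rw [h, one_smul]
    · rw [h, SL_neg_smul, one_smul]

theorem volume_upperHalfPlane_ne_zero : (volume : Measure ℍ) ≠ 0 := by
  intro h
  have h0 : (volume : Measure ℍ) 𝒟ᵒ = 0 := by rw [h]; simp
  have hopen : IsOpen ((↑) '' 𝒟ᵒ : Set ℂ) := isOpenEmbedding_coe.isOpenMap _ isOpen_fdo
  rw [volume_eq_lintegral, setLIntegral_eq_zero_iff hopen.measurableSet (by fun_prop)] at h0
  have hne : ((↑) '' 𝒟ᵒ : Set ℂ).Nonempty := by
    rw [coe_fdo]
    exact ⟨2 * Complex.I, by simp, by simp, by simp⟩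
  refine (hopen.measure_pos volume hne).ne' (measure_mono_null (fun z hz => ?_) (ae_iff.1 h0))
  obtain ⟨w, hw, rfl⟩ := hz
  intro hw'
  have := hw' ⟨w, hw, rfl⟩
  simp [w.im_ne_zero] at this

/-- `𝒟` lies in a vertical strip above height 1/2, where the integral of y⁻² converges. -/
theorem volume_fd_lt_top : volume 𝒟 < ⊤ := by
  have hsub : ((↑) '' 𝒟 : Set ℂ) ⊆
      Complex.measurableEquivRealProd ⁻¹' (Set.Icc (-1) 1 ×ˢ Set.Ioi (1 / 2)) := by
    rintro _ ⟨z, hz, rfl⟩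
    have h1 := abs_le.1 hz.2
    have h2 := three_le_four_mul_im_sq_of_mem_fd hz
    have h3 := z.im_pos
    refine ⟨⟨?_, ?_⟩, ?_⟩
    · change -1 ≤ z.re; linarith
    · change z.re ≤ 1; linarith
    · change 1 / 2 < z.im; nlinarith
  have hint : ∫⁻ y in Set.Ioi (1 / 2 : ℝ), (((1 / ‖y‖₊) ^ 2 : NNReal) : ENNReal) < ⊤ := by
    have h := (integrableOn_Ioi_rpow_of_lt (a := -2) (by norm_num)
      (show (0 : ℝ) < 1 / 2 by norm_num)).hasFiniteIntegral
    refine lt_of_le_of_lt (le_of_eq ?_) h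
    refine setLIntegral_congr_fun measurableSet_Ioi fun y hy => ?_
    have hy0 : (0 : ℝ) < y := lt_trans (by norm_num) hy
    change _ = ((‖y ^ (-2 : ℝ)‖₊ : NNReal) : ENNReal)
    rw [Real.rpow_neg hy0.le]
    simp
  rw [volume_eq_lintegral]
  refine (lintegral_mono_set hsub).trans_lt ?_
  have h := Complex.volume_preserving_equiv_real_prod.setLIntegral_comp_preimage_emb
    Complex.measurableEquivRealProd.measurableEmbedding
    (fun p : ℝ × ℝ => (((1 / ‖p.2‖₊) ^ 2 : NNReal) : ENNReal))
    (Set.Icc (-1) 1 ×ˢ Set.Ioi (1 / 2))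
  have h' := lintegral_prod_mul (μ := volume.restrict (Set.Icc (-1 : ℝ) 1))
    (ν := volume.restrict (Set.Ioi (1 / 2 : ℝ))) (f := fun _ => 1)
    (g := fun y : ℝ => (((1 / ‖y‖₊) ^ 2 : NNReal) : ENNReal)) (by fun_prop) (by fun_prop)
  rw [Measure.volume_eq_prod, ← Measure.prod_restrict] at h
  simp only [one_mul] at h'
  refine (h.trans h').trans_lt ?_
  refine ENNReal.mul_lt_top ?_ hint
  simp

end ModularGroup

/-! ### The index of Γ(N) and the area bound. -/

theorem card_SL2_zmod_lt (N : ℕ) (hN : 2 ≤ N) : Nat.card SL(2, ZMod N) < N ^ 3 := by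
  have : NeZero N := ⟨by omega⟩
  have : Fact (1 < N) := ⟨hN⟩
  classical
  have hdet : ∀ g : SL(2, ZMod N), g 0 0 * g 1 1 - g 0 1 * g 1 0 = 1 := fun g => by
    have := g.det_coe; rwa [Matrix.det_fin_two] at this
  let col : SL(2, ZMod N) → {v : ZMod N × ZMod N // v ≠ 0} := fun g => ⟨(g 0 0, g 1 0), fun h => by
    have h0 := congrArg Prod.fst h
    have h1 := congrArg Prod.snd h
    have := hdet g
    simp only [Prod.fst_zero, Prod.snd_zero] at h0 h1
    rw [h0, h1] at this
    simp at this⟩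
  -- The first column is nonzero, leaving fewer than N² choices. Matrices sharing it differ by right
  -- multiplication by an upper unipotent matrix, which is recorded by its corner entry.
  let f : SL(2, ZMod N) → {v : ZMod N × ZMod N // v ≠ 0} × ZMod N := fun g =>
    (col g, ((Function.invFun col (col g))⁻¹ * g) 0 1)
  have hf : Function.Injective f := by
    intro g g' hgg
    have hcol : col g = col g' := congrArg Prod.fst hgg
    have hcol0 : Function.invFun col (col g) = Function.invFun col (col g') := by rw [hcol]
    have h01 := congrArg Prod.snd hgg
    simp only [f] at h01
    rw [← hcol0] at h01
    have hk : col (Function.invFun col (col g)) = col g := Function.invFun_eq ⟨g, rfl⟩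
    generalize Function.invFun col (col g) = k at h01 hk
    have key : ∀ x : SL(2, ZMod N), col k = col x →
        (k⁻¹ * x) 0 0 = 1 ∧ (k⁻¹ * x) 1 0 = 0 ∧ (k⁻¹ * x) 1 1 = 1 := fun x hx => by
      have e0 : k 0 0 = x 0 0 := congrArg (fun v => v.1.1) hx
      have e1 : k 1 0 = x 1 0 := congrArg (fun v => v.1.2) hx
      have a0 : (k⁻¹ * x) 0 0 = 1 := by
        rw [Matrix.SpecialLinearGroup.coe_mul, Matrix.SpecialLinearGroup.coe_inv,
          Matrix.adjugate_fin_two, Matrix.mul_apply, Fin.sum_univ_two]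
        simp only [Matrix.of_apply, Matrix.cons_val]
        rw [← e0, ← e1]
        linear_combination hdet k
      have a1 : (k⁻¹ * x) 1 0 = 0 := by
        rw [Matrix.SpecialLinearGroup.coe_mul, Matrix.SpecialLinearGroup.coe_inv,
          Matrix.adjugate_fin_two, Matrix.mul_apply, Fin.sum_univ_two]
        simp only [Matrix.of_apply, Matrix.cons_val]
        rw [← e0, ← e1]
        ring
      have := hdet (k⁻¹ * x)
      rw [a0, a1] at this
      exact ⟨a0, a1, by linear_combination this⟩
    obtain ⟨a0, a1, a2⟩ := key g hk
    obtain ⟨b0, b1, b2⟩ := key g' (hk.trans hcol)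
    refine mul_left_cancel (a := k⁻¹) (Matrix.SpecialLinearGroup.ext _ _ fun i j => ?_)
    fin_cases i <;> fin_cases j
    · exact a0.trans b0.symm
    · exact h01
    · exact a1.trans b1.symm
    · exact a2.trans b2.symm
  have hcard := Nat.card_le_card_of_injective f hf
  refine hcard.trans_lt ?_
  have hv : Nat.card {v : ZMod N × ZMod N // v ≠ 0} < N * N := by
    rw [Nat.card_eq_fintype_card]
    refine (Fintype.card_subtype_lt (x := (0 : ZMod N × ZMod N)) (by simp)).trans_eq ?_
    rw [Fintype.card_prod, ZMod.card]
  rw [Nat.card_prod, Nat.card_zmod, pow_succ, sq]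
  exact Nat.mul_lt_mul_of_pos_right hv (by omega)

theorem area_Gamma_lt (N : ℕ) (hN : 2 ≤ N) :
    HasFundamentalDomain (transformationGroup (CongruenceSubgroup.Gamma N)) ℍ ∧
    HasFundamentalDomain (transformationGroup ⊤) ℍ ∧
    area (CongruenceSubgroup.Gamma N) < area ⊤ * (N : ENNReal) ^ 3 := by
  have hF := ModularGroup.isFundamentalDomain_fd
  have : NeZero N := ⟨by omega⟩
  have hle : transformationGroup (CongruenceSubgroup.Gamma N) ≤ transformationGroup ⊤ := by
    rw [transformationGroup_eq_map, transformationGroup_eq_map]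
    exact Subgroup.map_mono le_top
  have hF' := hF.cosetTranslates hle
  -- Passing to transformations can only lower the index, since ±1 become equal; divisibility also
  -- keeps it nonzero.
  have hdvd : (transformationGroup (CongruenceSubgroup.Gamma N)).relIndex (transformationGroup ⊤) ∣
      (CongruenceSubgroup.Gamma N).index := by
    rw [transformationGroup_eq_map, transformationGroup_eq_map, Subgroup.relIndex_map_map,
      top_sup_eq, Subgroup.relIndex_top_right]
    exact Subgroup.index_dvd_of_le le_sup_left
  have hidx0 : (CongruenceSubgroup.Gamma N).index ≠ 0 := Subgroup.FiniteIndex.index_ne_zero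
  have hidx : (CongruenceSubgroup.Gamma N).index < N ^ 3 := by
    refine lt_of_le_of_lt ?_ (card_SL2_zmod_lt N hN)
    rw [CongruenceSubgroup.Gamma, Subgroup.index_ker]
    exact Nat.card_le_card_of_injective _ Subtype.val_injective
  have hrel0 : (transformationGroup (CongruenceSubgroup.Gamma N)).relIndex
      (transformationGroup ⊤) ≠ 0 := fun h => hidx0 (by rw [h] at hdvd; exact zero_dvd_iff.1 hdvd)
  have hrel := (Nat.le_of_dvd (Nat.pos_of_ne_zero hidx0) hdvd).trans_lt hidx
  have : Finite (transformationGroup ⊤ ⧸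
      (transformationGroup (CongruenceSubgroup.Gamma N)).subgroupOf (transformationGroup ⊤)) :=
    Nat.finite_of_card_ne_zero hrel0
  refine ⟨hF'.hasFundamentalDomain _, hF.hasFundamentalDomain _, ?_⟩
  rw [area, area, hF.covolume_eq_volume, hF'.covolume_eq_volume, mul_comm]
  refine (measure_cosetTranslates_le (G := transformationGroup ⊤)).trans_lt ?_
  refine ENNReal.mul_lt_mul_left (hF.measure_ne_zero
    ModularGroup.volume_upperHalfPlane_ne_zero) ModularGroup.volume_fd_lt_top.ne ?_
  exact_mod_cast hrel

theorem mainTheorem4 (N : ℕ) (hN : 5 ≤ N) :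
    -- (a)
    (∀ γ ∈ CongruenceSubgroup.Gamma N, |(γ : Matrix (Fin 2) (Fin 2) ℤ).trace| ≠ 2 →
      (N : ℤ) ^ 2 - 2 ≤ |(γ : Matrix (Fin 2) (Fin 2) ℤ).trace|) ∧
    -- (b)
    (∀ β : SL(2, ℤ), ((β : Matrix (Fin 2) (Fin 2) ℤ).trace = N ∨
        (β : Matrix (Fin 2) (Fin 2) ℤ).trace = -N) →
      -(β ^ 2) ∈ CongruenceSubgroup.Gamma N ∧
      RepresentsSystole (CongruenceSubgroup.Gamma N) (-(β ^ 2))) ∧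
    -- (c): `Γ(N)` acts properly discontinuously and without fixed points
    (ProperlyDiscontinuousSMul (CongruenceSubgroup.Gamma N) ℍ ∧
      (∀ γ ∈ CongruenceSubgroup.Gamma N, γ ≠ 1 → ∀ z : ℍ, γ • z ≠ z) ∧
      -- the quotient is a non-compact hyperbolic surface
      IsHyperbolicSurface (HypQuotient (CongruenceSubgroup.Gamma N)) ∧
      ¬ CompactSpace (HypQuotient (CongruenceSubgroup.Gamma N)) ∧
      -- both areas are areas of actual fundamental domains, and they satisfy the inequality
      MeasureTheory.HasFundamentalDomain
        (transformationGroup (CongruenceSubgroup.Gamma N)) ℍ ∧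
      MeasureTheory.HasFundamentalDomain (transformationGroup ⊤) ℍ ∧
      area (CongruenceSubgroup.Gamma N) < area ⊤ * (N : ENNReal) ^ 3) := by
  have hΓ : ∀ γ ∈ CongruenceSubgroup.Gamma N, γ ≠ 1 → ∀ z : ℍ, γ • z ≠ z :=
    fun γ hγ h1 z => CongruenceSubgroup.smul_ne_of_mem_Gamma (by omega) hγ h1 z
  refine ⟨fun γ hγ h => CongruenceSubgroup.le_abs_trace_of_mem_Gamma hγ h, fun β hβ => ?_,
    inferInstance, hΓ, HypQuotient.isHyperbolicSurface hΓ, HypQuotient.not_compactSpace _,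
    area_Gamma_lt N (by omega)⟩
  have hmem : -(β ^ 2) ∈ CongruenceSubgroup.Gamma N :=
    CongruenceSubgroup.neg_sq_mem_Gamma (by rcases hβ with h | h <;> simp [h])
  refine ⟨hmem, CongruenceSubgroup.representsSystole_of_abs_trace_eq (by omega) hmem ?_⟩
  have hsq : (β : Matrix (Fin 2) (Fin 2) ℤ).trace ^ 2 = (N : ℤ) ^ 2 := by
    rcases hβ with h | h <;> rw [h]
    ring
  have hN2 : (5 : ℤ) ≤ N := by exact_mod_cast hN
  rw [CongruenceSubgroup.trace_neg_sq, hsq, abs_of_nonpos (by nlinarith)]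
  ring
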